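/- Let $k\ge 1$, let $\mathbb B_k\subset\mathbb R^k$ be the closed Euclidean unit ball, $f(x)=(1,x_1,\dots,x_k)^\top$, $\lambda:\mathbb R\to\mathbb R$, and $\beta=(\beta_0,\dots,\beta_k)^\top\in\mathbb R^{k+1}$ with $\beta_1\ge 0$ and $\beta_2=\dots=\beta_k=0$. For a probability measure (design) $\xi$ on $\mathbb B_k$ put $$M(\xi,\beta)=\int_{\mathbb B_k}\lambda\bigl(f(x)^\top\beta\bigr)\,f(x)f(x)^\top\,\xi(\mathrm dx),$$ and call $\xi$ locally $D$-optimal at $\beta$ if $M(\xi,\beta)$ is regular and $\det M(\xi,\beta)\ge\det M(\zeta,\beta)$ for all probability measures $\zeta$ on $\mathbb B_k$. For a probability measure $\xi_1$ on $[-1,1]$ let $\xi_1\otimes\overline\eta$ be the design on $\mathbb B_k$ under which $x_1$ has distribution $\xi_1$ and, given $x_1$, the vector $(x_2,\dots,x_k)$ is uniformly distributed on the sphere of radius $\sqrt{1-x_1^2}$ centred at the origin of $\mathbb R^{k-1}$ (for $k=1$, $\xi_1\otimes\overline\eta=\xi_1$). Call $\xi_1$ a locally $D$-optimal marginal design if $\xi_1\otimes\overline\eta$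 is locally $D$-optimal at $\beta$. Let $q(x)=\lambda(\beta_0+\beta_1x)$ and $u=1/q$, and assume that for some $c\in\mathbb R$: (A1) $q$ is positive on $\mathbb R$ and twice continuously differentiable; (A2$'$) $q'>0$ on $(-\infty,c)$ and $q'<0$ on $(c,\infty)$; (A3$'$) $u''$ is injective on $(-\infty,c]$ and injective on $[c,\infty)$. Then every locally $D$-optimal marginal design $\xi_1^*$ is concentrated either on exactly two points of $[-1,1]$, or on exactly three points $1$, $x_{12}^*\in(-1,1)$ and $-1$ (each of these points having positive mass). If in addition (A5) $\lim_{x\to\infty}|u(x)/x^2|=\infty$, then $\xi_1^*$ is concentrated on exactly two points of $[-1,1]$. -/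

import Mathlib

open MeasureTheory Filter Set

noncomputable section

namespace BallDesign

/-- A (generalized) design on the unit ball of `ℝᵏ`: a probability measure concentrated on it. -/
structure IsDesign {k : ℕ} (ξ : Measure (EuclideanSpace ℝ (Fin k))) : Prop where
  prob : IsProbabilityMeasure ξ
  ball : ξ (Metric.closedBall 0 1)ᶜ = 0

/-- The regression function `f(x) = (1, x₁, …, x_k)`. -/
def regression {k : ℕ} (x : EuclideanSpace ℝ (Fin k)) : Fin (k + 1) → ℝ :=
  Fin.cons 1 (fun i => x i)

/-- The linear predictor `f(x)ᵀβ = β₀ + β₁ x₁ + ⋯ + β_k x_k`. -/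
def predictor {k : ℕ} (β : Fin (k + 1) → ℝ) (x : EuclideanSpace ℝ (Fin k)) : ℝ :=
  ∑ i, regression x i * β i

/-- The information matrix `M(ξ, β) = ∫ lam(f(x)ᵀβ) f(x) f(x)ᵀ ξ(dx)` for the intensity `lam`. -/
def infoMatrix {k : ℕ} (lam : ℝ → ℝ) (β : Fin (k + 1) → ℝ)
    (ξ : Measure (EuclideanSpace ℝ (Fin k))) : Matrix (Fin (k + 1)) (Fin (k + 1)) ℝ :=
  Matrix.of fun i j => ∫ x, lam (predictor β x) * (regression x i * regression x j) ∂ξ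

/-- Local `D`-optimality at `β`: the information matrix is regular, and its determinant is maximal
among all probability measures on the unit ball. -/
structure IsDOptimal {k : ℕ} (lam : ℝ → ℝ) (β : Fin (k + 1) → ℝ)
    (ξ : Measure (EuclideanSpace ℝ (Fin k))) : Prop where
  design : IsDesign ξ
  regular : IsUnit (infoMatrix lam β ξ)
  maximal : ∀ ζ : Measure (EuclideanSpace ℝ (Fin k)), IsDesign ζ →
    (infoMatrix lam β ζ).det ≤ (infoMatrix lam β ξ).det

/-- The uniform distribution on the unit sphere of `ℝᵐ`: the normalized surface measure.
For `m = 0` (no remaining coordinates) it is the point mass at the only point of `ℝ⁰`. -/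
def uniformSphere : (m : ℕ) → Measure (EuclideanSpace ℝ (Fin m))
  | 0 => Measure.dirac 0
  | m + 1 =>
    let σ := (volume : Measure (EuclideanSpace ℝ (Fin (m + 1)))).toSphere
    ((σ univ)⁻¹ • σ).map Subtype.val

/-- The point `(t, √(1 - t²) s₁, …, √(1 - t²) s_m)` of `ℝᵐ⁺¹`. -/
def orbitPoint {m : ℕ} (p : ℝ × EuclideanSpace ℝ (Fin m)) : EuclideanSpace ℝ (Fin (m + 1)) :=
  WithLp.toLp 2 (Fin.cons p.1 (fun i => √(1 - p.1 ^ 2) * p.2 i))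

/-- The rotation invariant design `ξ₁ ⊗ η̄` on the ball of `ℝᵐ⁺¹`: the first coordinate `x₁` has
distribution `ξ₁` and, given `x₁`, the remaining `m` coordinates are uniformly distributed on the
sphere of radius `√(1 - x₁²)`. -/
def invariantDesign (m : ℕ) (ξ₁ : Measure ℝ) : Measure (EuclideanSpace ℝ (Fin (m + 1))) :=
  (ξ₁.prod (uniformSphere m)).map orbitPoint

/-- `ξ₁` is a locally `D`-optimal marginal design: a probability measure on `[-1, 1]` for which
`ξ₁ ⊗ η̄` is locally `D`-optimal on the ball. -/
structure IsDOptimalMarginal (m : ℕ) (lam : ℝ → ℝ) (β : Fin (m + 2) → ℝ)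
    (ξ₁ : Measure ℝ) : Prop where
  prob : IsProbabilityMeasure ξ₁
  interval : ξ₁ (Icc (-1) 1)ᶜ = 0
  optimal : IsDOptimal lam β (invariantDesign m ξ₁)

/-- (A1): `g` is positive and twice continuously differentiable on `ℝ`. -/
def CondA1 (g : ℝ → ℝ) : Prop := (∀ x, 0 < g x) ∧ ContDiff ℝ 2 g

/-- (A2'): `g` is unimodal with mode `c`. -/
def CondA2' (g : ℝ → ℝ) (c : ℝ) : Prop :=
  (∀ x, x < c → 0 < deriv g x) ∧ (∀ x, c < x → deriv g x < 0)

/-- (A3'): the second derivative of `u = 1 / g` is injective on `(-∞, c]` and on `[c, ∞)`. -/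
def CondA3' (g : ℝ → ℝ) (c : ℝ) : Prop :=
  InjOn (deriv (deriv fun x => 1 / g x)) (Iic c) ∧ InjOn (deriv (deriv fun x => 1 / g x)) (Ici c)

/-- (A5): `u = 1 / g` dominates `x²` asymptotically as `x → ∞`. -/
def CondA5 (g : ℝ → ℝ) : Prop :=
  Tendsto (fun x : ℝ => |(1 / g x) / x ^ 2|) atTop atTop

/-- `μ` is concentrated on exactly the points of `S`: no mass outside `S`, and positive mass
in every point of `S`. -/
def ConcentratedExactlyOn (μ : Measure ℝ) (S : Set ℝ) : Prop :=
  μ Sᶜ = 0 ∧ ∀ x ∈ S, 0 < μ {x}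

/-- `μ` is concentrated on exactly two points of `[-1, 1]`. -/
def TwoPoint (μ : Measure ℝ) : Prop :=
  ∃ x ∈ Icc (-1 : ℝ) 1, ∃ y ∈ Icc (-1 : ℝ) 1, x ≠ y ∧ ConcentratedExactlyOn μ {x, y}

/-- `μ` is concentrated on exactly the three points `1`, an interior point, and `-1`. -/
def ThreePoint (μ : Measure ℝ) : Prop :=
  ∃ x ∈ Ioo (-1 : ℝ) 1, ConcentratedExactlyOn μ {1, x, -1}

end BallDesign

end

/-!
The proof rests on the equivalence theorem for `D`-optimality, specialised to the orbits
`{x₁ = t}`, followed by a count of zeros.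

Let `M` be the information matrix of the optimal design and `E(t)` the second moment matrix of the
regression vector under the uniform distribution on the orbit `{x₁ = t}` (`orbitMoment`), so that
the information matrix of that orbit is `q(t) E(t)`. Moving mass from the optimal design to the
orbit cannot increase the determinant; the directional derivative gives
`q(t) tr(M⁻¹ E(t)) ≤ m + 2` for `t ∈ [-1, 1]` (`IsDOptimalMarginal.sensitivity_le`). The mean of the
left side under `ξ₁` is `tr(M⁻¹ M) = m + 2`, so equality holds `ξ₁`-almost everywhere
(`IsDOptimalMarginal.ae_sensitivity_eq`). Because the uniform distribution on the sphere is
symmetric, `tr(M⁻¹ E(t))` is a quadratic polynomial in `t` (`sensitivity_quadratic`); no further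
information on its moments is needed.

Dividing by `(m + 2) q`, a function `P = quadratic - u` satisfies `P ≤ 0` on `[-1, 1]`, and `ξ₁`
lives on the contact points `P = 0`. Injectivity of `u''` on the two half-lines allows at most two
zeros of `P''`, hence at most three zeros of `P'`. Three contact points `a < b < d` already produce
zeros of `P'` in `(a, b)`, at `b` and in `(b, d)`, and an interior `a` or `d` would add a fourth; so
`a = -1` and `d = 1` (`contact_endpoints`). A single support point would make `M` singular
(`IsDOptimalMarginal.compl_singleton_ne_zero`).

With three contact points, `P''` changes sign from negative to positive at its larger zero, which
lies to the right of `c`, and stays nonnegative from there on. So `P` is bounded below by a linear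
function near `∞`, and `u` grows at most quadratically, which the growth condition excludes
(`eventually_convex_of_three_contacts`, `not_superquadratic_of_eventually_convex`).
-/

namespace BallDesign

/-! ### Contact points of a quadratic with a function of injective curvature -/

/-- A function that is injective on both sides of `c` takes no value three times. -/
lemma not_three_of_injOn {g : ℝ → ℝ} {c : ℝ} (h₁ : InjOn g (Iic c)) (h₂ : InjOn g (Ici c))
    {a b d : ℝ} (hab : a < b) (hbd : b < d) (eab : g a = g b) (ebd : g b = g d) : False := by
  rcases le_total b c with h | h
  · exact hab.ne (h₁ (hab.le.trans h) h eab)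
  · exact hbd.ne (h₂ h (h.trans hbd.le) ebd)

/-! In this section `P` is a function with derivative `P'` and second derivative `κ - u''`; it
stands for a quadratic polynomial minus `u`. A contact point is a zero of `P` in `[-1, 1]`, where
`P ≤ 0`. -/
section Contact

variable {u P P' : ℝ → ℝ} {c κ : ℝ}

/-- Four zeros of `P'` would give three points of equal curvature `u'' = κ` by Rolle. -/
lemma not_four_critical (hP' : ∀ x, HasDerivAt P' (κ - deriv (deriv u) x) x)
    (h₁ : InjOn (deriv (deriv u)) (Iic c)) (h₂ : InjOn (deriv (deriv u)) (Ici c))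
    {a b d e : ℝ} (hab : a < b) (hbd : b < d) (hde : d < e)
    (ha : P' a = 0) (hb : P' b = 0) (hd : P' d = 0) (he : P' e = 0) : False := by
  have hc : Continuous P' := continuous_iff_continuousAt.2 fun x => (hP' x).continuousAt
  obtain ⟨r, hr, er⟩ := exists_hasDerivAt_eq_zero hab hc.continuousOn (ha.trans hb.symm)
    fun x _ => hP' x
  obtain ⟨s, hs, es⟩ := exists_hasDerivAt_eq_zero hbd hc.continuousOn (hb.trans hd.symm)
    fun x _ => hP' x
  obtain ⟨t, ht, et⟩ := exists_hasDerivAt_eq_zero hde hc.continuousOn (hd.trans he.symm)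
    fun x _ => hP' x
  exact not_three_of_injOn h₁ h₂ (hr.2.trans hs.1) (hs.2.trans ht.1) (by linarith) (by linarith)

variable (hP : ∀ x, HasDerivAt P (P' x) x)
include hP

lemma deriv_eq_zero_of_contact (hle : ∀ x ∈ Icc (-1 : ℝ) 1, P x ≤ 0) {x : ℝ}
    (hx : x ∈ Ioo (-1 : ℝ) 1) (h0 : P x = 0) : P' x = 0 := by
  have : IsLocalMax P x := by
    filter_upwards [Icc_mem_nhds hx.1 hx.2] with y hy
    rw [h0]; exact hle y hy
  exact this.hasDerivAt_eq_zero (hP x)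

/-- Interior contact points are double zeros of `P ≤ 0`; hence of three contact points the outer
two are the end points of the interval. -/
lemma contact_endpoints (hP' : ∀ x, HasDerivAt P' (κ - deriv (deriv u) x) x)
    (h₁ : InjOn (deriv (deriv u)) (Iic c)) (h₂ : InjOn (deriv (deriv u)) (Ici c))
    (hle : ∀ x ∈ Icc (-1 : ℝ) 1, P x ≤ 0) {a b d : ℝ} (hab : a < b) (hbd : b < d)
    (ha1 : -1 ≤ a) (hd1 : d ≤ 1) (ha : P a = 0) (hb : P b = 0) (hd : P d = 0) :
    a = -1 ∧ d = 1 := by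
  have hc : Continuous P := continuous_iff_continuousAt.2 fun x => (hP x).continuousAt
  obtain ⟨r, hr, er⟩ := exists_hasDerivAt_eq_zero hab hc.continuousOn (ha.trans hb.symm)
    fun x _ => hP x
  obtain ⟨s, hs, es⟩ := exists_hasDerivAt_eq_zero hbd hc.continuousOn (hb.trans hd.symm)
    fun x _ => hP x
  have eb := deriv_eq_zero_of_contact hP hle ⟨by linarith, by linarith⟩ hb
  constructor
  · by_contra hne
    have ea := deriv_eq_zero_of_contact hP hle
      ⟨lt_of_le_of_ne ha1 (Ne.symm hne), by linarith⟩ ha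
    exact not_four_critical hP' h₁ h₂ hr.1 hr.2 hs.1 ea er eb es
  · by_contra hne
    have ed := deriv_eq_zero_of_contact hP hle ⟨by linarith, lt_of_le_of_ne hd1 hne⟩ hd
    exact not_four_critical hP' h₁ h₂ hr.2 hs.1 hs.2 er eb es ed

/-- With three contact points, `P` is eventually convex. Indeed `P''` has exactly two zeros
`w < b < e` around the middle contact point `b`, with `c < e`. It is negative on `[b, e)` because
`P ≤ 0` has a contact at `b`, and it is strictly monotone on `[c, ∞)`, so it is nonnegative
beyond `e`. -/
lemma eventually_convex_of_three_contacts
    (hP' : ∀ x, HasDerivAt P' (κ - deriv (deriv u) x) x)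
    (hcont : Continuous (deriv (deriv u)))
    (h₁ : InjOn (deriv (deriv u)) (Iic c)) (h₂ : InjOn (deriv (deriv u)) (Ici c))
    (hle : ∀ x ∈ Icc (-1 : ℝ) 1, P x ≤ 0) {b : ℝ} (hb1 : b ∈ Ioo (-1 : ℝ) 1)
    (ha : P (-1) = 0) (hb : P b = 0) (hd : P 1 = 0) :
    ∃ e, ∀ x, e ≤ x → 0 ≤ κ - deriv (deriv u) x := by
  have hc : Continuous P := continuous_iff_continuousAt.2 fun x => (hP x).continuousAt
  have hc' : Continuous P' := continuous_iff_continuousAt.2 fun x => (hP' x).continuousAt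
  obtain ⟨r, hr, er⟩ := exists_hasDerivAt_eq_zero hb1.1 hc.continuousOn (ha.trans hb.symm)
    fun x _ => hP x
  obtain ⟨s, hs, es⟩ := exists_hasDerivAt_eq_zero hb1.2 hc.continuousOn (hb.trans hd.symm)
    fun x _ => hP x
  have eb := deriv_eq_zero_of_contact hP hle hb1 hb
  obtain ⟨w, hw, ew⟩ := exists_hasDerivAt_eq_zero hr.2 hc'.continuousOn (er.trans eb.symm)
    fun x _ => hP' x
  obtain ⟨e, he, ee⟩ := exists_hasDerivAt_eq_zero hs.1 hc'.continuousOn (eb.trans es.symm)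
    fun x _ => hP' x
  have hwe : w < e := hw.2.trans he.1
  have hce : c < e := by
    by_contra! h
    exact hwe.ne (h₁ (hwe.le.trans h) h (by linarith))
  have hne : ∀ x, w < x → x ≠ e → κ - deriv (deriv u) x ≠ 0 := by
    intro x hwx hxe h0
    rcases lt_or_gt_of_ne hxe with h | h
    · exact not_three_of_injOn h₁ h₂ hwx h (by linarith) (by linarith)
    · exact not_three_of_injOn h₁ h₂ hwe h (by linarith) (by linarith)
  have hcP : Continuous fun x => κ - deriv (deriv u) x := by fun_prop
  -- A nonnegative value of `P''` on `[b, e)` would make `P` increase to the right of the contact `b`.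
  have hneg : ∀ x ∈ Ico b e, κ - deriv (deriv u) x < 0 := by
    intro x hx
    by_contra! h
    have hpos : ∀ y ∈ Ico b e, 0 < κ - deriv (deriv u) y := by
      intro y hy
      by_contra! h'
      obtain ⟨z, hz, ez⟩ := isPreconnected_Ico.intermediate_value hy hx hcP.continuousOn ⟨h', h⟩
      exact hne z (hw.2.trans_le hz.1) hz.2.ne ez
    have hmono' : StrictMonoOn P' (Icc b e) :=
      strictMonoOn_of_deriv_pos (convex_Icc _ _) hc'.continuousOn fun y hy => by
        rw [interior_Icc] at hy
        rw [(hP' y).deriv]; exact hpos y ⟨hy.1.le, hy.2⟩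
    have hmono : StrictMonoOn P (Icc b e) :=
      strictMonoOn_of_deriv_pos (convex_Icc _ _) hc.continuousOn fun y hy => by
        rw [interior_Icc] at hy
        rw [(hP y).deriv, ← eb]
        exact hmono' (left_mem_Icc.2 he.1.le) ⟨hy.1.le, hy.2.le⟩ hy.1
    have h1 := hmono (left_mem_Icc.2 he.1.le) (right_mem_Icc.2 he.1.le) he.1
    have h2 := hle e ⟨by linarith [hb1.1, he.1], by linarith [he.2, hs.2]⟩
    linarith
  refine ⟨e, fun x hx => ?_⟩
  have hd' : max b c < e := max_lt he.1 hce
  have hdneg := hneg (max b c) ⟨le_max_left _ _, hd'⟩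
  have hsub : Icc (max b c) x ⊆ Ici c := fun y hy => (le_max_right _ _).trans hy.1
  rcases ContinuousOn.strictMonoOn_of_injOn_Icc' (hd'.le.trans hx) hcont.continuousOn
    (h₂.mono hsub) with h | h
  · have := h (left_mem_Icc.2 (hd'.le.trans hx)) ⟨hd'.le, hx⟩ hd'
    linarith
  · have := h.antitoneOn ⟨hd'.le, hx⟩ (right_mem_Icc.2 (hd'.le.trans hx)) hx
    linarith

/-- An eventually convex `P` lies above a linear function, so that `u = quadratic - P` is at most
quadratic. -/
lemma not_superquadratic_of_eventually_convex
    (hP' : ∀ x, HasDerivAt P' (κ - deriv (deriv u) x) x) {α γ δ : ℝ}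
    (hPu : ∀ x, P x = α + γ * x + δ * x ^ 2 - u x) (hu : ∀ x, 0 < u x)
    {e : ℝ} (he : ∀ x, e ≤ x → 0 ≤ κ - deriv (deriv u) x) :
    ¬ Tendsto (fun x : ℝ => |u x / x ^ 2|) atTop atTop := by
  intro hlim
  have hc : Continuous P := continuous_iff_continuousAt.2 fun x => (hP x).continuousAt
  have hc' : Continuous P' := continuous_iff_continuousAt.2 fun x => (hP' x).continuousAt
  have hmono' : MonotoneOn P' (Ici e) :=
    monotoneOn_of_deriv_nonneg (convex_Ici _) hc'.continuousOn
      (fun y _ => (hP' y).differentiableAt.differentiableWithinAt) fun y hy => by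
        rw [interior_Ici] at hy
        rw [(hP' y).deriv]; exact he y hy.le
  have hlow : ∀ x, e < x → P e + P' e * (x - e) ≤ P x := by
    intro x hx
    obtain ⟨z, hz, ez⟩ := exists_hasDerivAt_eq_slope P P' hx hc.continuousOn fun y _ => hP y
    rw [eq_div_iff (by linarith)] at ez
    have := hmono' self_mem_Ici hz.1.le hz.1.le
    nlinarith
  have hK := hlim.eventually_gt_atTop
    (|α - P e + P' e * e| + |γ - P' e| + |δ|)
  obtain ⟨x, hx, hx1, hxe⟩ :=
    (hK.and ((eventually_ge_atTop 1).and (eventually_gt_atTop e))).exists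
  have hx2 : 0 < x ^ 2 := by positivity
  rw [abs_of_pos (div_pos (hu x) hx2), lt_div_iff₀ hx2] at hx
  have h1 := hlow x hxe
  rw [hPu x] at h1
  have h2 : |α - P e + P' e * e| * 1 ≤ |α - P e + P' e * e| * x ^ 2 := by gcongr; nlinarith
  have h3 : |γ - P' e| * x ≤ |γ - P' e| * x ^ 2 := by gcongr; nlinarith
  have h4 : (γ - P' e) * x ≤ |γ - P' e| * x := by gcongr; exact le_abs_self _
  have h5 : δ * x ^ 2 ≤ |δ| * x ^ 2 := by gcongr; exact le_abs_self _
  have h6 := le_abs_self (α - P e + P' e * e)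
  nlinarith

end Contact

/-! ### The uniform distribution on the sphere -/

lemma toSphere_map_neg (m : ℕ) :
    ((volume : Measure (EuclideanSpace ℝ (Fin m))).toSphere).map (fun x => -x) =
      (volume : Measure (EuclideanSpace ℝ (Fin m))).toSphere := by
  have hneg : Measurable
      (fun x : Metric.sphere (0 : EuclideanSpace ℝ (Fin m)) 1 => -x) := continuous_neg.measurable
  ext s hs
  rw [Measure.map_apply hneg hs, Measure.toSphere_apply' _ hs,
    Measure.toSphere_apply' _ (hneg hs), ← Measure.measure_preimage_neg]
  congr 2
  ext x
  simp only [Set.mem_smul, mem_image, mem_preimage]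
  constructor
  · rintro ⟨r, hr, _, ⟨y, hy, rfl⟩, hx⟩
    exact ⟨r, hr, _, ⟨-y, hy, rfl⟩, by rw [coe_neg_sphere, smul_neg, hx, neg_neg]⟩
  · rintro ⟨r, hr, _, ⟨y, hy, rfl⟩, hx⟩
    exact ⟨r, hr, _, ⟨-y, by simpa using hy, rfl⟩, by rw [coe_neg_sphere, smul_neg, hx]⟩

instance isProbabilityMeasure_uniformSphere (m : ℕ) : IsProbabilityMeasure (uniformSphere m) := by
  cases m with
  | zero => unfold uniformSphere; infer_instance
  | succ m =>
    unfold uniformSphere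
    have : NeZero (volume : Measure (EuclideanSpace ℝ (Fin (m + 1)))).toSphere :=
      ⟨Measure.toSphere_ne_zero _⟩
    exact Measure.isProbabilityMeasure_map measurable_subtype_coe.aemeasurable

lemma ae_norm_le_one_uniformSphere (m : ℕ) : ∀ᵐ s ∂uniformSphere m, ‖s‖ ≤ 1 := by
  cases m with
  | zero => exact Eventually.of_forall fun s => by simp [Subsingleton.elim s 0]
  | succ m =>
    unfold uniformSphere
    rw [ae_map_iff measurable_subtype_coe.aemeasurable
      (measurableSet_le measurable_norm measurable_const)]
    exact Eventually.of_forall fun s => (norm_eq_of_mem_sphere s).le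

lemma uniformSphere_map_neg (m : ℕ) :
    (uniformSphere m).map (fun s => -s) = uniformSphere m := by
  cases m with
  | zero => rw [show (fun s : EuclideanSpace ℝ (Fin 0) => -s) = id from
      funext fun s => Subsingleton.elim _ _, Measure.map_id]
  | succ m =>
    unfold uniformSphere
    have hneg : Measurable (fun x : Metric.sphere (0 : EuclideanSpace ℝ (Fin (m + 1))) 1 => -x) :=
      continuous_neg.measurable
    dsimp only
    rw [Measure.map_map measurable_neg measurable_subtype_coe,
      show ((fun s => -s) ∘ Subtype.val :
        Metric.sphere (0 : EuclideanSpace ℝ (Fin (m + 1))) 1 → _) =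
        Subtype.val ∘ (fun x => -x) from funext fun x => (coe_neg_sphere x).symm,
      ← Measure.map_map measurable_subtype_coe hneg, Measure.map_smul, toSphere_map_neg]

lemma integral_coord_uniformSphere (m : ℕ) (i : Fin m) : ∫ s, s i ∂uniformSphere m = 0 := by
  have h : ∫ s, s i ∂uniformSphere m = ∫ s, -s i ∂uniformSphere m := by
    conv_lhs => rw [← uniformSphere_map_neg m]
    rw [integral_map measurable_neg.aemeasurable (by fun_prop)]
    rfl
  rw [integral_neg] at h
  linarith

/-! ### Invariant designs and their information matrices -/

lemma continuous_regression {k : ℕ} (i : Fin (k + 1)) :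
    Continuous fun x : EuclideanSpace ℝ (Fin k) => regression x i := by
  unfold regression
  refine Fin.cases ?_ (fun i => ?_) i
  · simp only [Fin.cons_zero]; fun_prop
  · simp only [Fin.cons_succ]; fun_prop

lemma continuous_orbitPoint (m : ℕ) : Continuous (orbitPoint (m := m)) := by
  unfold orbitPoint
  refine (PiLp.continuous_toLp 2 _).comp (continuous_pi fun i => ?_)
  refine Fin.cases ?_ (fun i => ?_) i
  · simp only [Fin.cons_zero]; fun_prop
  · simp only [Fin.cons_succ]; fun_prop

lemma norm_orbitPoint_le {m : ℕ} {t : ℝ} (ht : t ∈ Icc (-1 : ℝ) 1)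
    {s : EuclideanSpace ℝ (Fin m)} (hs : ‖s‖ ≤ 1) : ‖orbitPoint (t, s)‖ ≤ 1 := by
  have h1 : (0 : ℝ) ≤ 1 - t ^ 2 := by nlinarith [ht.1, ht.2]
  have h2 : ‖s‖ ^ 2 ≤ 1 := by nlinarith [norm_nonneg s]
  rw [EuclideanSpace.norm_sq_eq] at h2
  rw [← sq_le_one_iff₀ (norm_nonneg _), EuclideanSpace.norm_sq_eq, Fin.sum_univ_succ]
  simp only [orbitPoint, Fin.cons_zero, Fin.cons_succ, Real.norm_eq_abs, sq_abs, mul_pow,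
    Real.sq_sqrt h1, ← Finset.mul_sum] at h2 ⊢
  nlinarith

lemma isDesign_invariantDesign {m : ℕ} {ζ : Measure ℝ} [IsProbabilityMeasure ζ]
    (hζ : ζ (Icc (-1) 1)ᶜ = 0) : IsDesign (invariantDesign m ζ) where
  prob := Measure.isProbabilityMeasure_map (continuous_orbitPoint m).measurable.aemeasurable
  ball := by
    have hm : MeasurableSet {x : EuclideanSpace ℝ (Fin (m + 1)) | x ∈ Metric.closedBall 0 1} :=
      measurableSet_closedBall
    have h : ∀ᵐ x ∂invariantDesign m ζ, x ∈ Metric.closedBall 0 1 := by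
      rw [invariantDesign, ae_map_iff (continuous_orbitPoint m).measurable.aemeasurable hm]
      have h1 : ∀ᵐ p ∂ζ.prod (uniformSphere m), p.1 ∈ Icc (-1 : ℝ) 1 :=
        Measure.quasiMeasurePreserving_fst.ae (mem_ae_iff.2 hζ)
      have h2 : ∀ᵐ p ∂ζ.prod (uniformSphere m), ‖p.2‖ ≤ 1 :=
        Measure.quasiMeasurePreserving_snd.ae (ae_norm_le_one_uniformSphere m)
      filter_upwards [h1, h2] with p hp1 hp2
      simpa using norm_orbitPoint_le hp1 hp2
    exact mem_ae_iff.1 h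

lemma IsDesign.integrable {k : ℕ} {ξ : Measure (EuclideanSpace ℝ (Fin k))} (hξ : IsDesign ξ)
    {F : EuclideanSpace ℝ (Fin k) → ℝ} (hF : Continuous F) : Integrable F ξ := by
  have := hξ.prob
  have h := hF.continuousOn.integrableOn_compact (μ := ξ) (isCompact_closedBall 0 1)
  have hae : ∀ᵐ x ∂ξ, x ∈ Metric.closedBall 0 1 := mem_ae_iff.2 hξ.ball
  rwa [IntegrableOn, Measure.restrict_eq_self_of_ae_mem hae] at h

lemma predictor_eq {m : ℕ} {β : Fin (m + 2) → ℝ} (hβ : ∀ i, i ≠ 0 → i ≠ 1 → β i = 0)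
    (x : EuclideanSpace ℝ (Fin (m + 1))) : predictor β x = β 0 + β 1 * x 0 := by
  have h : ∀ i : Fin m, β i.succ.succ = 0 := fun i => by
    refine hβ _ (Fin.succ_ne_zero _) fun h => ?_
    rw [← Fin.succ_zero_eq_one, Fin.succ_inj] at h
    exact Fin.succ_ne_zero _ h
  rw [predictor, Fin.sum_univ_succ, Fin.sum_univ_succ]
  simp [h, regression, mul_comm]

/-- The second moments of the regression vector on the orbit `{x₁ = t}`: the information matrix
of the orbit, up to the factor `q(t)`. -/
noncomputable def orbitMoment (m : ℕ) (t : ℝ) : Matrix (Fin (m + 2)) (Fin (m + 2)) ℝ :=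
  Matrix.of fun i j =>
    ∫ s, regression (orbitPoint (t, s)) i * regression (orbitPoint (t, s)) j ∂uniformSphere m

/-- Since the uniform distribution on the sphere is centred, the square root `√(1 - t²)` only
enters squared: on `[-1, 1]` the orbit moments are quadratic polynomials. -/
lemma orbitMoment_quadratic (m : ℕ) (i j : Fin (m + 2)) :
    ∃ α γ δ : ℝ, ∀ t ∈ Icc (-1 : ℝ) 1, orbitMoment m t i j = α + γ * t + δ * t ^ 2 := by
  simp only [orbitMoment, Matrix.of_apply, regression, orbitPoint]
  refine Fin.cases ?_ (fun i => Fin.cases ?_ (fun i => ?_) i) i <;>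
    refine Fin.cases ?_ (fun j => Fin.cases ?_ (fun j => ?_) j) j <;>
    simp only [Fin.cons_zero, Fin.cons_succ]
  · exact ⟨1, 0, 0, fun t _ => by simp⟩
  · exact ⟨0, 1, 0, fun t _ => by simp⟩
  · exact ⟨0, 0, 0, fun t _ => by
      simp only [integral_const_mul, integral_coord_uniformSphere]; ring⟩
  · exact ⟨0, 1, 0, fun t _ => by simp⟩
  · exact ⟨0, 0, 1, fun t _ => by simp; ring⟩
  · exact ⟨0, 0, 0, fun t _ => by
      simp only [integral_const_mul, integral_coord_uniformSphere]; ring⟩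
  · exact ⟨0, 0, 0, fun t _ => by
      simp only [integral_const_mul, integral_mul_const, integral_coord_uniformSphere]; ring⟩
  · exact ⟨0, 0, 0, fun t _ => by
      simp only [integral_const_mul, integral_mul_const, integral_coord_uniformSphere]; ring⟩
  · refine ⟨∫ s, s i * s j ∂uniformSphere m, 0, -∫ s, s i * s j ∂uniformSphere m, fun t ht => ?_⟩
    have h1 : (0 : ℝ) ≤ 1 - t ^ 2 := by nlinarith [ht.1, ht.2]
    simp only [mul_mul_mul_comm, Real.mul_self_sqrt h1, integral_const_mul]
    ring

lemma orbitMoment_one_right (m : ℕ) (t : ℝ) (i : Fin (m + 2)) :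
    orbitMoment m t i 1 = t * orbitMoment m t i 0 := by
  simp only [orbitMoment, Matrix.of_apply, ← integral_const_mul]
  refine integral_congr_ae (Eventually.of_forall fun s => ?_)
  simp [regression, orbitPoint, ← Fin.succ_zero_eq_one, -Fin.succ_zero_eq_one', mul_comm]

section Info

variable {m : ℕ} {lam : ℝ → ℝ} {β : Fin (m + 2) → ℝ} {q : ℝ → ℝ}

lemma continuous_infoIntegrand (hβ : ∀ i, i ≠ 0 → i ≠ 1 → β i = 0)
    (hq : ∀ t, q t = lam (β 0 + β 1 * t)) (hqc : Continuous q) (i j : Fin (m + 2)) :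
    Continuous fun x : EuclideanSpace ℝ (Fin (m + 1)) =>
      lam (predictor β x) * (regression x i * regression x j) := by
  simp only [predictor_eq hβ, ← hq]
  have := continuous_regression (k := m + 1) i
  have := continuous_regression (k := m + 1) j
  fun_prop

/-- Integrating out the sphere turns the information matrix of `ζ ⊗ η̄` into a mixture of the
information matrices `q(t) E(t)` of single orbits. Here `lam` itself need not be measurable: along
the ball only `q` enters. -/
lemma integrable_and_infoMatrix_invariantDesign (hβ : ∀ i, i ≠ 0 → i ≠ 1 → β i = 0)
    (hq : ∀ t, q t = lam (β 0 + β 1 * t)) (hqc : Continuous q)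
    {ζ : Measure ℝ} [IsProbabilityMeasure ζ] (hζ : ζ (Icc (-1) 1)ᶜ = 0) (i j : Fin (m + 2)) :
    Integrable (fun t => q t * orbitMoment m t i j) ζ ∧
      infoMatrix lam β (invariantDesign m ζ) i j = ∫ t, q t * orbitMoment m t i j ∂ζ := by
  have hF := continuous_infoIntegrand hβ hq hqc i j
  have hint := (isDesign_invariantDesign (m := m) hζ).integrable hF
  have hmeas := (continuous_orbitPoint m).measurable.aemeasurable (μ := ζ.prod (uniformSphere m))
  have heq : ∀ t, ∫ s, lam (predictor β (orbitPoint (t, s))) *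
      (regression (orbitPoint (t, s)) i * regression (orbitPoint (t, s)) j) ∂uniformSphere m =
      q t * orbitMoment m t i j := by
    intro t
    have h0 : ∀ s : EuclideanSpace ℝ (Fin m), orbitPoint (t, s) 0 = t := fun s => rfl
    simp only [predictor_eq hβ, ← hq, h0, integral_const_mul, orbitMoment, Matrix.of_apply]
  rw [invariantDesign, integrable_map_measure hF.aestronglyMeasurable hmeas] at hint
  constructor
  · have := hint.integral_prod_left
    simpa only [Function.comp_apply, heq] using this
  · rw [infoMatrix, Matrix.of_apply, invariantDesign,
      integral_map hmeas hF.aestronglyMeasurable]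
    exact (integral_prod _ hint).trans (by simp only [Function.comp_apply, heq])

end Info

/-! ### The equivalence inequality -/

/-- If the determinant does not increase from `M` towards `N`, then its directional derivative
`det M * (tr(M⁻¹ N) - card n)` is nonpositive. -/
lemma trace_inv_mul_le_of_det_le {n : Type*} [Fintype n] [DecidableEq n] {M N : Matrix n n ℝ}
    (hM : 0 < M.det) (h : ∀ ε ∈ Ioo (0 : ℝ) 1, ((1 - ε) • M + ε • N).det ≤ M.det) :
    (M⁻¹ * N).trace ≤ Fintype.card n := by
  have hu : IsUnit M.det := hM.ne'.isUnit
  set K : Matrix n n ℝ := M⁻¹ * N - 1 with hK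
  -- `det (M (1 + ε K)) = det M * (1 + tr K * ε + O(ε²))`; divide by `ε` and let `ε → 0`.
  have hfac : ∀ ε : ℝ, (1 - ε) • M + ε • N = M * (1 + ε • K) := by
    intro ε
    rw [hK, mul_add, mul_one, mul_smul_comm, mul_sub, mul_one,
      Matrix.mul_nonsing_inv_cancel_left _ _ hu]
    module
  set R : Polynomial ℝ :=
    (Matrix.det (1 + (Polynomial.X : Polynomial ℝ) • K.map Polynomial.C)).divX.divX with hR
  have hle : ∀ ε ∈ Ioo (0 : ℝ) 1, K.trace + R.eval ε * ε ≤ 0 := by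
    intro ε hε
    have h1 := h ε hε
    rw [hfac, Matrix.det_mul, Matrix.det_one_add_smul] at h1
    have h2 : 1 + K.trace * ε + R.eval ε * ε ^ 2 ≤ 1 := by
      by_contra! h3
      nlinarith [mul_lt_mul_of_pos_left h3 hM]
    by_contra! h3
    nlinarith [mul_pos h3 hε.1]
  have hlim : Tendsto (fun ε : ℝ => K.trace + R.eval ε * ε) (nhdsWithin 0 (Ioi 0))
      (nhds (K.trace + R.eval 0 * 0)) :=
    (Continuous.tendsto (by fun_prop) 0).mono_left nhdsWithin_le_nhds
  have h0 : K.trace + R.eval 0 * 0 ≤ 0 :=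
    le_of_tendsto hlim (by filter_upwards [Ioo_mem_nhdsGT one_pos] with ε hε using hle ε hε)
  rw [mul_zero, add_zero, hK, Matrix.trace_sub, Matrix.trace_one] at h0
  linarith

lemma infoMatrix_dirac_zero_det {m : ℕ} (lam : ℝ → ℝ) (β : Fin (m + 2) → ℝ) :
    (infoMatrix lam β (Measure.dirac (0 : EuclideanSpace ℝ (Fin (m + 1))))).det = 0 := by
  refine Matrix.det_eq_zero_of_row_eq_zero 1 fun j => ?_
  simp [infoMatrix, regression, ← Fin.succ_zero_eq_one, -Fin.succ_zero_eq_one']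

lemma isDesign_dirac_zero (k : ℕ) :
    IsDesign (Measure.dirac (0 : EuclideanSpace ℝ (Fin k))) where
  prob := inferInstance
  ball := by
    rw [Measure.dirac_apply' _ measurableSet_closedBall.compl]
    simp

lemma IsDesign.convexCombination {k : ℕ} {ξ ζ : Measure (EuclideanSpace ℝ (Fin k))}
    (hξ : IsDesign ξ) (hζ : IsDesign ζ) {ε : ℝ} (hε : ε ∈ Ioo (0 : ℝ) 1) :
    IsDesign (ENNReal.ofReal (1 - ε) • ξ + ENNReal.ofReal ε • ζ) where
  prob := by
    have := hξ.prob
    have := hζ.prob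
    constructor
    rw [Measure.add_apply, Measure.smul_apply, Measure.smul_apply, measure_univ, measure_univ,
      smul_eq_mul, smul_eq_mul, mul_one, mul_one, ← ENNReal.ofReal_add (by linarith [hε.2]) hε.1.le]
    simp
  ball := by simp [hξ.ball, hζ.ball]

section Optimal

variable {m : ℕ} {lam : ℝ → ℝ} {β : Fin (m + 2) → ℝ} {q : ℝ → ℝ}

/-- The determinant at an optimal design is nonzero by regularity, and nonnegative because a
one-point design has determinant `0`. -/
lemma IsDOptimal.det_pos {ξ : Measure (EuclideanSpace ℝ (Fin (m + 1)))}
    (h : IsDOptimal lam β ξ) : 0 < (infoMatrix lam β ξ).det := by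
  have h0 := h.maximal _ (isDesign_dirac_zero _)
  rw [infoMatrix_dirac_zero_det] at h0
  exact lt_of_le_of_ne h0 ((Matrix.isUnit_iff_isUnit_det _).1 h.regular).ne_zero.symm

lemma IsDOptimal.trace_le (hβ : ∀ i, i ≠ 0 → i ≠ 1 → β i = 0)
    (hq : ∀ t, q t = lam (β 0 + β 1 * t)) (hqc : Continuous q)
    {ξ ζ : Measure (EuclideanSpace ℝ (Fin (m + 1)))}
    (h : IsDOptimal lam β ξ) (hζ : IsDesign ζ) :
    ((infoMatrix lam β ξ)⁻¹ * infoMatrix lam β ζ).trace ≤ m + 2 := by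
  have := trace_inv_mul_le_of_det_le (N := infoMatrix lam β ζ) h.det_pos fun ε hε => by
    convert h.maximal _ (h.design.convexCombination hζ hε) using 2
    ext i j
    have hF := continuous_infoIntegrand hβ hq hqc i j
    simp only [infoMatrix, Matrix.add_apply, Matrix.smul_apply, Matrix.of_apply, smul_eq_mul]
    rw [integral_add_measure ((h.design.integrable hF).smul_measure ENNReal.ofReal_ne_top)
      ((hζ.integrable hF).smul_measure ENNReal.ofReal_ne_top), integral_smul_measure,
      integral_smul_measure, ENNReal.toReal_ofReal (by linarith [hε.2]),
      ENNReal.toReal_ofReal hε.1.le, smul_eq_mul, smul_eq_mul]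
  simp only [Fintype.card_fin] at this
  push_cast at this
  linarith

/-- The sensitivity function `tr(M⁻¹ E(t))` of the invariant design with marginal `ξ₁` and
information matrix `M`, where `E(t)` is the orbit moment matrix; the factor `q(t)` is left out. -/
noncomputable def sensitivity (lam : ℝ → ℝ) (β : Fin (m + 2) → ℝ) (ξ₁ : Measure ℝ) (t : ℝ) : ℝ :=
  ((infoMatrix lam β (invariantDesign m ξ₁))⁻¹ * orbitMoment m t).trace

lemma sensitivity_quadratic (lam : ℝ → ℝ) (β : Fin (m + 2) → ℝ) (ξ₁ : Measure ℝ) :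
    ∃ α γ δ : ℝ, ∀ t ∈ Icc (-1 : ℝ) 1,
      sensitivity lam β ξ₁ t = α + γ * t + δ * t ^ 2 := by
  choose α γ δ h using orbitMoment_quadratic m
  set K := (infoMatrix lam β (invariantDesign m ξ₁))⁻¹ with hK
  refine ⟨∑ i, ∑ j, K i j * α j i, ∑ i, ∑ j, K i j * γ j i, ∑ i, ∑ j, K i j * δ j i,
    fun t ht => ?_⟩
  simp only [sensitivity, ← hK, Matrix.trace, Matrix.diag, Matrix.mul_apply, h _ _ t ht,
    Finset.sum_mul, ← Finset.sum_add_distrib]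
  exact Finset.sum_congr rfl fun i _ => Finset.sum_congr rfl fun j _ => by ring

variable {ξ₁ : Measure ℝ}

/-- The directional derivative of the determinant towards a single orbit `{x₁ = t}`. -/
lemma IsDOptimalMarginal.sensitivity_le (hβ : ∀ i, i ≠ 0 → i ≠ 1 → β i = 0)
    (hq : ∀ t, q t = lam (β 0 + β 1 * t)) (hqc : Continuous q)
    (h : IsDOptimalMarginal m lam β ξ₁) {t : ℝ} (ht : t ∈ Icc (-1 : ℝ) 1) :
    q t * sensitivity lam β ξ₁ t ≤ m + 2 := by
  have hd : Measure.dirac t (Icc (-1 : ℝ) 1)ᶜ = 0 := by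
    rw [Measure.dirac_apply' _ measurableSet_Icc.compl]; simp [ht.1, ht.2]
  have h1 := h.optimal.trace_le hβ hq hqc (isDesign_invariantDesign (m := m) hd)
  have h2 : infoMatrix lam β (invariantDesign m (Measure.dirac t)) = q t • orbitMoment m t := by
    ext i j
    rw [(integrable_and_infoMatrix_invariantDesign hβ hq hqc hd i j).2, integral_dirac]
    rfl
  rwa [h2, mul_smul_comm, Matrix.trace_smul, smul_eq_mul] at h1

/-- The sensitivity function of an optimal design has mean `tr(M⁻¹ M) = m + 2` under the design
itself, so it attains its upper bound almost everywhere. -/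
lemma IsDOptimalMarginal.ae_sensitivity_eq (hβ : ∀ i, i ≠ 0 → i ≠ 1 → β i = 0)
    (hq : ∀ t, q t = lam (β 0 + β 1 * t)) (hqc : Continuous q)
    (h : IsDOptimalMarginal m lam β ξ₁) :
    ∀ᵐ t ∂ξ₁, t ∈ Icc (-1 : ℝ) 1 ∧ q t * sensitivity lam β ξ₁ t = m + 2 := by
  have := h.prob
  have hI : ∀ᵐ t ∂ξ₁, t ∈ Icc (-1 : ℝ) 1 := mem_ae_iff.2 h.interval
  have hent := integrable_and_infoMatrix_invariantDesign hβ hq hqc h.interval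
  set M := infoMatrix lam β (invariantDesign m ξ₁) with hM
  have hexp : ∀ t, q t * sensitivity lam β ξ₁ t =
      ∑ i, ∑ j, M⁻¹ i j * (q t * orbitMoment m t j i) := by
    intro t
    simp only [sensitivity, ← hM, Matrix.trace, Matrix.diag, Matrix.mul_apply, Finset.mul_sum]
    exact Finset.sum_congr rfl fun i _ => Finset.sum_congr rfl fun j _ => by ring
  have hint1 : ∀ i j, Integrable (fun t => M⁻¹ i j * (q t * orbitMoment m t j i)) ξ₁ :=
    fun i j => (hent j i).1.const_mul _
  have hint : Integrable (fun t => q t * sensitivity lam β ξ₁ t) ξ₁ := by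
    simp only [hexp]
    exact integrable_finsetSum _ fun i _ => integrable_finsetSum _ fun j _ => hint1 i j
  have hmean : ∫ t, q t * sensitivity lam β ξ₁ t ∂ξ₁ = m + 2 := by
    have h1 : (M⁻¹ * M).trace = m + 2 := by
      rw [Matrix.nonsing_inv_mul _ h.optimal.det_pos.ne'.isUnit, Matrix.trace_one, Fintype.card_fin]
      push_cast
      ring
    rw [← h1]
    simp only [hexp]
    rw [integral_finsetSum _ fun i _ => integrable_finsetSum _ fun j _ => hint1 i j]
    simp only [Matrix.trace, Matrix.diag, Matrix.mul_apply]
    refine Finset.sum_congr rfl fun i _ => ?_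
    rw [integral_finsetSum _ fun j _ => hint1 i j]
    refine Finset.sum_congr rfl fun j _ => ?_
    rw [integral_const_mul, (hent j i).2]
  have hnn : 0 ≤ᵐ[ξ₁] fun t => (m + 2 : ℝ) - q t * sensitivity lam β ξ₁ t := by
    filter_upwards [hI] with t ht
    exact sub_nonneg.2 (h.sensitivity_le hβ hq hqc ht)
  have hzero : ∫ t, ((m + 2 : ℝ) - q t * sensitivity lam β ξ₁ t) ∂ξ₁ = 0 := by
    rw [integral_sub (integrable_const _) hint, hmean]; simp
  rw [integral_eq_zero_iff_of_nonneg_ae hnn ((integrable_const _).sub hint)] at hzero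
  filter_upwards [hI, hzero] with t ht h0
  exact ⟨ht, (sub_eq_zero.1 h0).symm⟩

/-- For a one-point marginal design, the first coordinate is constant and the information matrix
is singular. -/
lemma IsDOptimalMarginal.compl_singleton_ne_zero (hβ : ∀ i, i ≠ 0 → i ≠ 1 → β i = 0)
    (hq : ∀ t, q t = lam (β 0 + β 1 * t)) (hqc : Continuous q)
    (h : IsDOptimalMarginal m lam β ξ₁) (t : ℝ) : ξ₁ {t}ᶜ ≠ 0 := by
  intro h0
  have := h.prob
  have hae : ∀ᵐ x ∂ξ₁, x = t := mem_ae_iff.2 h0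
  have hent := integrable_and_infoMatrix_invariantDesign hβ hq hqc h.interval
  refine h.optimal.det_pos.ne' (Matrix.exists_mulVec_eq_zero_iff.1
    ⟨Pi.single 1 1 - t • Pi.single 0 1, fun hv => ?_, ?_⟩)
  · simpa using congrFun hv 1
  · -- `(-t, 1, 0, …)` is orthogonal to every regression vector with `x₁ = t`.
    ext i
    rw [Matrix.mulVec_sub, Matrix.mulVec_smul]
    simp only [Matrix.mulVec_single_one, Pi.sub_apply, Pi.smul_apply, Matrix.col_apply,
      smul_eq_mul, Pi.zero_apply, sub_eq_zero]
    rw [(hent i 1).2, (hent i 0).2, ← integral_const_mul]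
    refine integral_congr_ae ?_
    filter_upwards [hae] with x hx
    rw [orbitMoment_one_right, hx]; ring

end Optimal

/-! ### The support -/

/-- A non-degenerate set of contact points consists of at most two points, or of both end points
and one interior point. -/
lemma contact_set_cases {Z : Set ℝ} (hZ : Z ⊆ Icc (-1) 1) (hne : ∀ t, ¬ Z ⊆ {t})
    (htri : ∀ a ∈ Z, ∀ b ∈ Z, ∀ d ∈ Z, a < b → b < d → a = -1 ∧ d = 1) :
    (∃ x ∈ Icc (-1 : ℝ) 1, ∃ y ∈ Icc (-1 : ℝ) 1, x ≠ y ∧ Z ⊆ {x, y}) ∨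
      ∃ b ∈ Ioo (-1 : ℝ) 1, Z = {1, b, -1} := by
  by_cases h3 : ∃ a ∈ Z, ∃ b ∈ Z, ∃ d ∈ Z, a < b ∧ b < d
  · obtain ⟨a, ha, b, hb, d, hd, hab, hbd⟩ := h3
    obtain ⟨rfl, rfl⟩ := htri a ha b hb d hd hab hbd
    refine Or.inr ⟨b, ⟨hab, hbd⟩, Subset.antisymm (fun z hz => ?_) ?_⟩
    · simp only [mem_insert_iff, mem_singleton_iff]
      by_contra! hz'
      have h1 := lt_of_le_of_ne (hZ hz).1 hz'.2.2.symm
      have h2 := lt_of_le_of_ne (hZ hz).2 hz'.1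
      rcases lt_or_gt_of_ne hz'.2.1 with h | h
      · exact hbd.ne (htri _ ha _ hz _ hb h1 h).2
      · exact h2.ne (htri _ ha _ hb _ hz hab h).2
    · rintro z (rfl | rfl | rfl) <;> assumption
  · left
    obtain ⟨a, ha, -⟩ := not_subset.1 (hne 0)
    obtain ⟨b, hb, hba⟩ := not_subset.1 (hne a)
    refine ⟨a, hZ ha, b, hZ hb, fun h => hba h.symm, fun z hz => ?_⟩
    simp only [mem_insert_iff, mem_singleton_iff] at hba ⊢
    by_contra! hz'
    refine h3 ?_
    rcases lt_or_gt_of_ne hba with h | h <;> rcases lt_or_gt_of_ne hz'.1 with h1 | h1 <;>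
      rcases lt_or_gt_of_ne hz'.2 with h2 | h2
    · exact ⟨z, hz, b, hb, a, ha, h2, h⟩
    · exact ⟨b, hb, z, hz, a, ha, h2, h1⟩
    · exact (lt_asymm h (h1.trans h2)).elim
    · exact ⟨b, hb, a, ha, z, hz, h, h1⟩
    · exact ⟨z, hz, a, ha, b, hb, h1, h⟩
    · exact (lt_asymm h (h2.trans h1)).elim
    · exact ⟨a, ha, z, hz, b, hb, h1, h2⟩
    · exact ⟨a, ha, b, hb, z, hz, h, h2⟩

section Support

variable {μ : Measure ℝ} (hμ : ∀ t, μ {t}ᶜ ≠ 0)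
include hμ

lemma twoPoint_of_compl_null {x y : ℝ} (hx : x ∈ Icc (-1 : ℝ) 1) (hy : y ∈ Icc (-1 : ℝ) 1)
    (hxy : x ≠ y) (h : μ {x, y}ᶜ = 0) : TwoPoint μ := by
  have key : ∀ a b : ℝ, μ {a, b}ᶜ = 0 → 0 < μ {a} := by
    intro a b hab
    refine pos_iff_ne_zero.2 fun h0 => hμ b (measure_mono_null (fun z hz => ?_)
      (measure_union_null hab h0))
    by_cases hza : z = a
    · exact Or.inr hza
    · exact Or.inl (by simpa [hza] using hz)
  refine ⟨x, hx, y, hy, hxy, h, ?_⟩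
  rintro z (rfl | rfl)
  · exact key _ _ h
  · exact key _ x (by rwa [pair_comm])

lemma twoPoint_or_threePoint_of_compl_null {b : ℝ} (hb : b ∈ Ioo (-1 : ℝ) 1)
    (h : μ {1, b, -1}ᶜ = 0) : TwoPoint μ ∨ ThreePoint μ := by
  have hb' := Ioo_subset_Icc_self hb
  have drop : ∀ a x y : ℝ, μ {a, x, y}ᶜ = 0 → μ {a} = 0 → μ {x, y}ᶜ = 0 := by
    intro a x y ht h0
    refine measure_mono_null (fun z hz => ?_) (measure_union_null ht h0)
    by_cases hza : z = a
    · exact Or.inr hza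
    · exact Or.inl (by simpa [hza] using hz)
  by_cases h1 : μ {1} = 0
  · exact Or.inl (twoPoint_of_compl_null hμ hb' (by simp) hb.1.ne' (drop _ _ _ h h1))
  by_cases h2 : μ {b} = 0
  · refine Or.inl (twoPoint_of_compl_null hμ (x := 1) (y := -1) (by simp) (by simp) (by norm_num)
      (drop b _ _ ?_ h2))
    rwa [insert_comm]
  by_cases h3 : μ {-1} = 0
  · refine Or.inl (twoPoint_of_compl_null hμ (x := 1) (y := b) (by simp) hb' hb.2.ne'
      (drop (-1) _ _ ?_ h3))
    rwa [insert_comm, pair_comm (-1) b]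
  refine Or.inr ⟨b, hb, h, ?_⟩
  rintro z (rfl | rfl | rfl) <;> exact pos_iff_ne_zero.2 ‹_›

end Support

end BallDesign

open BallDesign in
theorem mainTheorem2 (m : ℕ) (lam : ℝ → ℝ) (β : Fin (m + 2) → ℝ)
    (hβ₁ : 0 ≤ β 1) (hβ : ∀ i, i ≠ 0 → i ≠ 1 → β i = 0)
    (q : ℝ → ℝ) (hq : ∀ t, q t = lam (β 0 + β 1 * t))
    (c : ℝ) (hA1 : BallDesign.CondA1 q) (hA2 : BallDesign.CondA2' q c)
    (hA3 : BallDesign.CondA3' q c)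
    (ξ₁ : MeasureTheory.Measure ℝ) (hξ₁ : BallDesign.IsDOptimalMarginal m lam β ξ₁) :
    (BallDesign.TwoPoint ξ₁ ∨ BallDesign.ThreePoint ξ₁) ∧
      (BallDesign.CondA5 q → BallDesign.TwoPoint ξ₁) := by
  obtain ⟨hpos, hq2⟩ := hA1
  obtain ⟨hinj₁, hinj₂⟩ := hA3
  have hqc : Continuous q := hq2.continuous
  have hns := hξ₁.compl_singleton_ne_zero hβ hq hqc
  set u : ℝ → ℝ := fun x => 1 / q x with hu
  have hu0 : ∀ x, 0 < u x := fun x => one_div_pos.2 (hpos x)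
  have hu2 : ContDiff ℝ 2 u := contDiff_const.div hq2 fun x => (hpos x).ne'
  have hu1' : ContDiff ℝ 1 (deriv u) := ((contDiff_succ_iff_deriv (n := 1)).1 hu2).2.2
  have hu2c : Continuous (deriv (deriv u)) := hu1'.continuous_deriv le_rfl
  have hm : (0 : ℝ) < m + 2 := by positivity
  obtain ⟨α, γ, δ, hquad⟩ := sensitivity_quadratic lam β ξ₁
  -- The gap in the equivalence inequality, divided by `(m + 2) * q`.
  set P : ℝ → ℝ := fun x =>
    α / (m + 2) + γ / (m + 2) * x + δ / (m + 2) * x ^ 2 - u x with hPdef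
  set P' : ℝ → ℝ := fun x => γ / (m + 2) + 2 * (δ / (m + 2)) * x - deriv u x with hP'def
  have hP : ∀ x, HasDerivAt P (P' x) x := by
    intro x
    have h1 := (hu2.differentiable (by norm_num) x).hasDerivAt
    have h2 := ((((hasDerivAt_id x).const_mul (γ / (m + 2))).const_add (α / (m + 2))).add
      (((hasDerivAt_id x).pow 2).const_mul (δ / (m + 2)))).sub h1
    refine h2.congr_deriv ?_
    simp [hP'def]; ring
  have hP' : ∀ x, HasDerivAt P' (2 * (δ / (m + 2)) - deriv (deriv u) x) x := by
    intro x
    have h1 := (hu1'.differentiable (by norm_num) x).hasDerivAt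
    have h2 := (((hasDerivAt_id x).const_mul (2 * (δ / (m + 2)))).const_add (γ / (m + 2))).sub h1
    refine h2.congr_deriv ?_
    simp
  have hPq : ∀ x ∈ Icc (-1 : ℝ) 1,
      P x * ((m + 2) * q x) = q x * sensitivity lam β ξ₁ x - (m + 2) := by
    intro x hx
    have := (hpos x).ne'
    rw [hquad x hx]
    simp only [hPdef, hu]
    field_simp
  have hle : ∀ x ∈ Icc (-1 : ℝ) 1, P x ≤ 0 := by
    intro x hx
    have h1 := hξ₁.sensitivity_le hβ hq hqc hx
    have h2 := hPq x hx
    have h3 := mul_pos hm (hpos x)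
    by_contra! h4
    nlinarith [mul_pos h4 h3]
  set Z : Set ℝ := {x | x ∈ Icc (-1 : ℝ) 1 ∧ P x = 0} with hZdef
  have hZ : ξ₁ Zᶜ = 0 := by
    have : ∀ᵐ x ∂ξ₁, x ∈ Z := by
      filter_upwards [hξ₁.ae_sensitivity_eq hβ hq hqc] with x hx
      refine ⟨hx.1, ?_⟩
      have h2 := hPq x hx.1
      rw [hx.2, sub_self] at h2
      exact (mul_eq_zero.1 h2).resolve_right (mul_pos hm (hpos x)).ne'
    exact mem_ae_iff.1 this
  have hsub : ∀ S : Set ℝ, Z ⊆ S → ξ₁ Sᶜ = 0 := fun S hS =>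
    measure_mono_null (compl_subset_compl.2 hS) hZ
  rcases contact_set_cases (Z := Z) (fun z hz => hz.1) (fun t ht => hns t (hsub _ ht))
    (fun a ha b hb d hd hab hbd => contact_endpoints hP hP' hinj₁ hinj₂ hle hab hbd
      ha.1.1 hd.1.2 ha.2 hb.2 hd.2) with ⟨x, hx, y, hy, hxy, hS⟩ | ⟨b, hb, hS⟩
  · have h2 := twoPoint_of_compl_null hns hx hy hxy (hsub _ hS)
    exact ⟨Or.inl h2, fun _ => h2⟩
  · refine ⟨twoPoint_or_threePoint_of_compl_null hns hb (hsub _ hS.subset), fun h5 => ?_⟩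
    have hmem : ∀ x ∈ ({1, b, -1} : Set ℝ), P x = 0 := fun x hx => by
      rw [← hS] at hx; exact hx.2
    obtain ⟨e, he⟩ := eventually_convex_of_three_contacts hP hP' hu2c hinj₁ hinj₂ hle hb
      (hmem _ (by simp)) (hmem _ (by simp)) (hmem _ (by simp))
    exact (not_superquadratic_of_eventually_convex hP hP' (fun x => rfl) hu0 he h5).elim
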